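/- For integers $k_1,k_2$ let $$\mathrm{Li}_{k_1,k_2}(z)=\sum_{0<m_1<m_2}\frac{z^{m_2}}{m_1^{k_1}m_2^{k_2}}\qquad(|z|<1),$$ and define rational numbers $B_m^{(k_1,k_2)}$ $(m\ge 0)$ by $$\frac{\mathrm{Li}_{k_1,k_2}(1-e^{-t})}{1-e^{-t}}=\sum_{m=0}^{\infty}B_m^{(k_1,k_2)}\frac{t^m}{m!}.$$ Theorem. Let $n\ge 0$ and $k\ge 1$ be integers. The function $\mathrm{Li}_{-n,k}$ has a (unique) holomorphic continuation to $\mathbb{C}\setminus[1,\infty)$, again denoted $\mathrm{Li}_{-n,k}$, and the integral in $$\eta(-n,k;s)=\frac{1}{\Gamma(s)}\int_0^\infty t^{s-1}\,\frac{\mathrm{Li}_{-n,k}(1-e^t)}{1-e^t}\,dt\qquad(\Re(s)>0)$$ converges absolutely for all $s\in\mathbb{C}$ with $\Re(s)>0$. The function $s\mapsto\eta(-n,k;s)$ can be analytically continued to an entire function, and the values of this continuation at nonpositive integers are given by $$\eta(-n,k;-m)=B_m^{(-n,k)}\qquad(m\in\mathbb{Z}_{\ge 0}).$$ -/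

import Mathlib

namespace MixedEta

/-- The coefficient of `z ^ m` in the double polylogarithm
`Li_{k₁,k₂}(z) = ∑_{0 < m₁ < m₂} z ^ m₂ / (m₁ ^ k₁ * m₂ ^ k₂)`, for integers `k₁, k₂`. -/
def liCoeff (k₁ k₂ : ℤ) (m : ℕ) : ℚ :=
  ∑ m₁ ∈ Finset.Ioo 0 m, 1 / ((m₁ : ℚ) ^ k₁ * (m : ℚ) ^ k₂)

/-- The plane cut along `[1, ∞)`. -/
def cutPlane : Set ℂ := {z : ℂ | z.re < 1 ∨ z.im ≠ 0}

/-- `L` is the double polylogarithm `Li_{k₁,k₂}`: it is the sum of the defining series in the open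
unit disc, and it is holomorphic on `ℂ \ [1, ∞)`. On that (connected) domain these two properties
determine `L`. -/
structure IsDoublePolylog (k₁ k₂ : ℤ) (L : ℂ → ℂ) : Prop where
  hasSum : ∀ z : ℂ, ‖z‖ < 1 → HasSum (fun m : ℕ => (liCoeff k₁ k₂ m : ℂ) * z ^ m) (L z)
  differentiableOn : DifferentiableOn ℂ L cutPlane

/-- The double polylogarithm `Li_{k₁,k₂}`, continued analytically to `ℂ \ [1, ∞)`. -/
noncomputable def doublePolylog (k₁ k₂ : ℤ) : ℂ → ℂ :=
  Classical.epsilon (IsDoublePolylog k₁ k₂)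

/-- The integrand `t ^ (s - 1) * Li_{k₁,k₂}(1 - e ^ t) / (1 - e ^ t)` of the eta function. -/
noncomputable def etaIntegrand (k₁ k₂ : ℤ) (s : ℂ) (t : ℝ) : ℂ :=
  (t : ℂ) ^ (s - 1) *
    (doublePolylog k₁ k₂ (1 - Complex.exp (t : ℂ)) / (1 - Complex.exp (t : ℂ)))

/-- `η(k₁, k₂; s)` as defined by its integral (to be used for `Re s > 0`). -/
noncomputable def eta (k₁ k₂ : ℤ) (s : ℂ) : ℂ :=
  1 / Complex.Gamma s * ∫ t in Set.Ioi (0 : ℝ), etaIntegrand k₁ k₂ s t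

/-- The formal power series `1 - e ^ (-t)`. -/
noncomputable def oneSubExpNeg : PowerSeries ℚ :=
  1 - PowerSeries.evalNegHom (PowerSeries.exp ℚ)

/-- The formal power series `Li_{k₁,k₂}(1 - e ^ (-t)) / (1 - e ^ (-t))`: the series
`Li_{k₁,k₂}(z) / z = ∑ m, liCoeff k₁ k₂ (m + 1) * z ^ m` at `z = 1 - e ^ (-t)`. -/
noncomputable def bernoulliGen (k₁ k₂ : ℤ) : PowerSeries ℚ :=
  (PowerSeries.mk fun m : ℕ => liCoeff k₁ k₂ (m + 1)).subst oneSubExpNeg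

/-- The multi-poly-Bernoulli number `B_m^{(k₁,k₂)}`, defined by
`Li_{k₁,k₂}(1 - e ^ (-t)) / (1 - e ^ (-t)) = ∑ m, B_m^{(k₁,k₂)} * t ^ m / m!`. -/
noncomputable def polyBernoulli (k₁ k₂ : ℤ) (m : ℕ) : ℚ :=
  (m.factorial : ℚ) * PowerSeries.coeff m (bernoulliGen k₁ k₂)

theorem hasSubst_oneSubExpNeg : PowerSeries.HasSubst oneSubExpNeg := by
  apply PowerSeries.HasSubst.of_constantCoeff_zero'
  rw [oneSubExpNeg, PowerSeries.evalNegHom, map_sub,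
    ← PowerSeries.coeff_zero_eq_constantCoeff_apply, ← PowerSeries.coeff_zero_eq_constantCoeff_apply,
    PowerSeries.coeff_rescale]
  simp

theorem liCoeff_zero (k₁ k₂ : ℤ) : liCoeff k₁ k₂ 0 = 0 := by
  simp [liCoeff]

/-- `bernoulliGen` is indeed the quotient of `Li_{k₁,k₂}(1 - e ^ (-t))` by `1 - e ^ (-t)`. -/
theorem oneSubExpNeg_mul_bernoulliGen (k₁ k₂ : ℤ) :
    oneSubExpNeg * bernoulliGen k₁ k₂ =
      (PowerSeries.mk fun m : ℕ => liCoeff k₁ k₂ m).subst oneSubExpNeg := by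
  have h : (PowerSeries.mk fun m : ℕ => liCoeff k₁ k₂ m) =
      PowerSeries.X * PowerSeries.mk fun m : ℕ => liCoeff k₁ k₂ (m + 1) := by
    ext m
    cases m with
    | zero => simp [liCoeff_zero]
    | succ m => simp [PowerSeries.coeff_succ_X_mul]
  rw [h, PowerSeries.subst_mul hasSubst_oneSubExpNeg, PowerSeries.subst_X hasSubst_oneSubExpNeg,
    bernoulliGen]

end MixedEta

namespace MixedEta

open Filter Topology Asymptotics Set MeasureTheory

theorem inv_Gamma_eq_prod_mul (s : ℂ) (n : ℕ) :
    (Complex.Gamma s)⁻¹ = (∏ i ∈ Finset.range n, (s + i)) * (Complex.Gamma (s + n))⁻¹ := by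
  induction n with
  | zero => simp
  | succ n ih =>
    rw [ih, Complex.one_div_Gamma_eq_self_mul_one_div_Gamma_add_one (s + n), Finset.prod_range_succ]
    push_cast
    rw [mul_assoc, add_assoc]

/-- The entire continuation of `1 / (Γ(s) * (s + j))`. -/
noncomputable def invGammaDiv (j : ℕ) (s : ℂ) : ℂ :=
  (∏ i ∈ Finset.range j, (s + i)) * (Complex.Gamma (s + (j + 1 : ℕ)))⁻¹

theorem invGammaDiv_eq {j : ℕ} {s : ℂ} (h : s + j ≠ 0) :
    invGammaDiv j s = (Complex.Gamma s)⁻¹ * (1 / (s + j)) := by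
  rw [inv_Gamma_eq_prod_mul s (j + 1), Finset.prod_range_succ, invGammaDiv]
  field_simp

theorem differentiable_invGammaDiv (j : ℕ) : Differentiable ℂ (invGammaDiv j) := by
  unfold invGammaDiv
  refine Differentiable.mul (by fun_prop) ?_
  exact Complex.differentiable_one_div_Gamma.comp (differentiable_id.add_const _)

theorem invGammaDiv_neg_self (m : ℕ) :
    invGammaDiv m (-(m : ℂ)) = (-1) ^ m * (m.factorial : ℂ) := by
  rw [invGammaDiv]
  have h : (-(m : ℂ) + (m + 1 : ℕ)) = 1 := by push_cast; ring
  rw [h, Complex.Gamma_one, inv_one, mul_one, ← Finset.prod_range_reflect,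
    ← Finset.prod_range_add_one_eq_factorial]
  push_cast
  have hc : ((-1 : ℂ)) ^ m = ∏ _i ∈ Finset.range m, (-1 : ℂ) := by simp
  rw [hc, ← Finset.prod_mul_distrib]
  refine Finset.prod_congr rfl fun i hi => ?_
  rw [Finset.mem_range] at hi
  rw [Nat.sub_sub, Nat.cast_sub (by lia)]
  push_cast
  ring

theorem invGammaDiv_neg_of_lt {j m : ℕ} (h : j < m) : invGammaDiv j (-(m : ℂ)) = 0 := by
  rw [invGammaDiv]
  have : (-(m : ℂ) + (j + 1 : ℕ)) = -((m - (j + 1) : ℕ) : ℂ) := by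
    rw [Nat.cast_sub (by lia)]; ring
  rw [this, Complex.Gamma_neg_nat_eq_zero, inv_zero, mul_zero]

/-- The difference between `F` and the polynomial `∑ j < N, a j * t ^ j` cut off outside
`(0, 1]`. -/
noncomputable def subTaylor (F : ℝ → ℂ) (a : ℕ → ℂ) (N : ℕ) (t : ℝ) : ℂ :=
  F t - (Ioc (0 : ℝ) 1).indicator (fun t : ℝ => ∑ j ∈ Finset.range N, a j * (t : ℂ) ^ j) t

section

variable {F : ℝ → ℂ} {a : ℕ → ℂ}

theorem locallyIntegrableOn_subTaylor (hF : LocallyIntegrableOn F (Ioi 0)) (N : ℕ) :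
    LocallyIntegrableOn (subTaylor F a N) (Ioi 0) := by
  refine hF.sub (LocallyIntegrable.locallyIntegrableOn ?_ _)
  refine Integrable.locallyIntegrable ?_
  rw [integrable_indicator_iff measurableSet_Ioc]
  exact (Continuous.integrableOn_Icc (by fun_prop)).mono_set Ioc_subset_Icc_self

theorem subTaylor_isBigO_atTop (hF : ∀ b : ℝ, F =O[atTop] (fun t : ℝ => t ^ (-b))) (N : ℕ)
    (b : ℝ) : subTaylor F a N =O[atTop] (fun t : ℝ => t ^ (-b)) := by
  refine (hF b).congr' ?_ EventuallyEq.rfl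
  filter_upwards [eventually_gt_atTop 1] with t ht
  rw [subTaylor, indicator_of_notMem (by simp [ht]), sub_zero]

theorem subTaylor_isBigO_zero {N : ℕ}
    (hF : (fun t : ℝ => F t - ∑ j ∈ Finset.range N, a j * (t : ℂ) ^ j) =O[𝓝[>] 0]
      (fun t : ℝ => t ^ N)) :
    subTaylor F a N =O[𝓝[>] 0] (fun t : ℝ => t ^ (-(-(N : ℝ)))) := by
  refine hF.congr' ?_ (.of_forall fun t => by simp only [neg_neg, Real.rpow_natCast])
  filter_upwards [Ioc_mem_nhdsGT zero_lt_one] with t ht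
  rw [subTaylor, indicator_of_mem ht]

/-- The continuation of `Γ(s)⁻¹ * mellin F s` to `-N < re s` obtained from the first `N` terms of
the asymptotic expansion of `F` at `0`. -/
noncomputable def mellinExt (F : ℝ → ℂ) (a : ℕ → ℂ) (N : ℕ) (s : ℂ) : ℂ :=
  (Complex.Gamma s)⁻¹ * mellin (subTaylor F a N) s +
    ∑ j ∈ Finset.range N, a j * invGammaDiv j s

variable (hloc : LocallyIntegrableOn F (Ioi 0))
  (htop : ∀ b : ℝ, F =O[atTop] (fun t : ℝ => t ^ (-b)))
  (hzero : ∀ N : ℕ, (fun t : ℝ => F t - ∑ j ∈ Finset.range N, a j * (t : ℂ) ^ j) =O[𝓝[>] 0]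
      (fun t : ℝ => t ^ N))

include hloc htop hzero

theorem mellinConvergent_subTaylor {N : ℕ} {s : ℂ} (hs : -(N : ℝ) < s.re) :
    MellinConvergent (subTaylor F a N) s :=
  mellinConvergent_of_isBigO_rpow (locallyIntegrableOn_subTaylor hloc N)
    (subTaylor_isBigO_atTop htop N (s.re + 1)) (by linarith) (subTaylor_isBigO_zero (hzero N)) hs

theorem differentiableAt_mellinExt {N : ℕ} {s : ℂ} (hs : -(N : ℝ) < s.re) :
    DifferentiableAt ℂ (mellinExt F a N) s := by
  unfold mellinExt
  refine ((Complex.differentiable_one_div_Gamma s).mul ?_).add ?_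
  · exact mellin_differentiableAt_of_isBigO_rpow (locallyIntegrableOn_subTaylor hloc N)
      (subTaylor_isBigO_atTop htop N (s.re + 1)) (by linarith) (subTaylor_isBigO_zero (hzero N)) hs
  · exact DifferentiableAt.fun_sum fun j _ => ((differentiable_invGammaDiv j) s).const_mul _

theorem mellinExt_succ {N : ℕ} {s : ℂ} (hs : -(N : ℝ) < s.re) :
    mellinExt F a (N + 1) s = mellinExt F a N s := by
  have h0 : s + N ≠ 0 := fun h => by
    have := congrArg Complex.re h
    simp at this
    linarith
  have h1 := hasMellin_cpow_Ioc (N : ℂ) (s := s) (by simp; linarith)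
  have h2 := hasMellin_const_smul h1.1 (a N)
  have h3 := hasMellin_add (mellinConvergent_subTaylor hloc htop hzero
    (N := N + 1) (s := s) (by push_cast; linarith)) h2.1
  have h4 : (fun t => subTaylor F a (N + 1) t +
      a N • (Ioc (0 : ℝ) 1).indicator (fun t : ℝ => (t : ℂ) ^ (N : ℂ)) t) = subTaylor F a N := by
    ext t
    by_cases ht : t ∈ Ioc (0 : ℝ) 1
    · simp only [subTaylor, indicator_of_mem ht, Finset.sum_range_succ, smul_eq_mul,
        Complex.cpow_natCast]
      ring
    · simp only [subTaylor, indicator_of_notMem ht, smul_zero, add_zero]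
  rw [h4] at h3
  rw [mellinExt, mellinExt, h3.2, h2.2, h1.2, Finset.sum_range_succ, invGammaDiv_eq h0, smul_eq_mul]
  ring

theorem mellinExt_eq {N M : ℕ} {s : ℂ} (hs : -(N : ℝ) < s.re) (hNM : N ≤ M) :
    mellinExt F a M s = mellinExt F a N s := by
  induction M, hNM using Nat.le_induction with
  | base => rfl
  | succ M hM ih =>
    rw [mellinExt_succ hloc htop hzero, ih]
    have : (N : ℝ) ≤ M := by exact_mod_cast hM
    linarith

/-- If `F` decays rapidly at infinity and has an asymptotic expansion `∑ a j * t ^ j` at `0`, then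
`Γ(s)⁻¹ * ∫ t ^ (s - 1) * F t` continues to an entire function with values
`(-1) ^ m * m! * a m` at `-m`. -/
theorem exists_entire_eq_inv_Gamma_mul_mellin :
    (∀ s : ℂ, 0 < s.re → MellinConvergent F s) ∧
    ∃ E : ℂ → ℂ, Differentiable ℂ E ∧
      (∀ s : ℂ, 0 < s.re → E s = (Complex.Gamma s)⁻¹ * mellin F s) ∧
      ∀ m : ℕ, E (-(m : ℂ)) = (-1) ^ m * (m.factorial : ℂ) * a m := by
  have hsub : subTaylor F a 0 = F := by ext t; simp [subTaylor]
  let E : ℂ → ℂ := fun s => mellinExt F a (⌈-s.re⌉₊ + 1) s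
  have hE : ∀ (N : ℕ) (s : ℂ), -(N : ℝ) < s.re → E s = mellinExt F a N s := by
    intro N s hs
    have h1 : -((⌈-s.re⌉₊ + 1 : ℕ) : ℝ) < s.re := by
      have := Nat.le_ceil (-s.re)
      push_cast
      linarith
    rcases le_total N (⌈-s.re⌉₊ + 1) with h | h
    · exact mellinExt_eq hloc htop hzero hs h
    · exact (mellinExt_eq hloc htop hzero h1 h).symm
  refine ⟨fun s hs => ?_, E, fun s => ?_, fun s hs => ?_, fun m => ?_⟩
  · simpa [hsub] using mellinConvergent_subTaylor hloc htop hzero (N := 0) (s := s) (by simpa)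
  · obtain ⟨N, hN⟩ := exists_nat_gt (-s.re)
    have hN' : -(N : ℝ) < s.re := by linarith
    refine (differentiableAt_mellinExt hloc htop hzero hN').congr_of_eventuallyEq ?_
    filter_upwards [(isOpen_lt continuous_const Complex.continuous_re).mem_nhds hN'] with z hz
      using hE N z hz
  · rw [hE 0 s (by simpa), mellinExt, hsub]
    simp
  · rw [hE (m + 1) _ (by simp), mellinExt, Complex.Gamma_neg_nat_eq_zero, inv_zero, zero_mul,
      zero_add, Finset.sum_range_succ, Finset.sum_eq_zero, zero_add, invGammaDiv_neg_self]
    · ring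
    · intro j hj
      rw [invGammaDiv_neg_of_lt (Finset.mem_range.mp hj), mul_zero]

end

/-- The formal power series `φ` is the asymptotic expansion of `f` at `0`. -/
def HasAsymp (f : ℂ → ℂ) (φ : PowerSeries ℚ) : Prop :=
  ∀ N : ℕ, ∃ p : Polynomial ℚ, (PowerSeries.X : PowerSeries ℚ) ^ N ∣ φ - p ∧
    (fun z => f z - Polynomial.aeval z p) =O[𝓝 0] (fun z => z ^ N)

theorem X_pow_dvd_sub_trunc (φ : PowerSeries ℚ) (N : ℕ) :
    (PowerSeries.X : PowerSeries ℚ) ^ N ∣ φ - PowerSeries.trunc N φ := by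
  rw [PowerSeries.X_pow_dvd_iff]
  intro m hm
  rw [map_sub, PowerSeries.coeff_coe_trunc_of_lt hm, sub_self]

theorem aeval_trunc (φ : PowerSeries ℚ) (N : ℕ) (z : ℂ) :
    Polynomial.aeval z (PowerSeries.trunc N φ) =
      ∑ j ∈ Finset.range N, ((PowerSeries.coeff j φ : ℚ) : ℂ) * z ^ j := by
  rw [Polynomial.aeval_def, PowerSeries.eval₂_trunc_eq_sum_range]
  simp

theorem isBigO_aeval_sub {p : Polynomial ℚ} {f g u : ℂ → ℂ}
    (hf : Tendsto f (𝓝 0) (𝓝 0)) (hg : Tendsto g (𝓝 0) (𝓝 0))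
    (h : (fun z => f z - g z) =O[𝓝 0] u) :
    (fun z => Polynomial.aeval (f z) p - Polynomial.aeval (g z) p) =O[𝓝 0] u := by
  have h1 : HasStrictDerivAt (fun z : ℂ => Polynomial.aeval z p) _ 0 :=
    p.hasStrictDerivAt_aeval 0
  exact (h1.isBigO_sub.comp_tendsto (hf.prodMk_nhds hg)).trans h

theorem isBigO_aeval_of_X_pow_dvd {p : Polynomial ℚ} {N : ℕ}
    (h : (PowerSeries.X : PowerSeries ℚ) ^ N ∣ (p : PowerSeries ℚ)) :
    (fun z : ℂ => Polynomial.aeval z p) =O[𝓝 0] (fun z => z ^ N) := by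
  have h' : (Polynomial.X : Polynomial ℚ) ^ N ∣ p := by
    rw [Polynomial.X_pow_dvd_iff]
    rw [PowerSeries.X_pow_dvd_iff] at h
    simpa using h
  obtain ⟨r, rfl⟩ := h'
  have hr : (fun z : ℂ => Polynomial.aeval z r) =O[𝓝 0] (fun _ => (1 : ℂ)) :=
    r.continuous_aeval.continuousAt.isBigO_one ℂ
  simpa using (isBigO_refl (fun z : ℂ => z ^ N) (𝓝 0)).mul hr

theorem HasAsymp.isBigO_sub_sum {f : ℂ → ℂ} {φ : PowerSeries ℚ} (h : HasAsymp f φ) (N : ℕ) :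
    (fun z => f z - ∑ j ∈ Finset.range N, ((PowerSeries.coeff j φ : ℚ) : ℂ) * z ^ j) =O[𝓝 0]
      (fun z => z ^ N) := by
  obtain ⟨p, hp, hf⟩ := h N
  have h1 := isBigO_aeval_of_X_pow_dvd (p := p - PowerSeries.trunc N φ) (N := N) (by
    simpa using dvd_sub (X_pow_dvd_sub_trunc φ N) hp)
  refine (hf.add h1).congr_left fun z => ?_
  rw [map_sub, aeval_trunc]
  ring

theorem hasAsymp_of_isBigO {f : ℂ → ℂ} {φ : PowerSeries ℚ}
    (h : ∀ N : ℕ, (fun z => f z - ∑ j ∈ Finset.range N, ((PowerSeries.coeff j φ : ℚ) : ℂ) * z ^ j)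
      =O[𝓝 0] (fun z => z ^ N)) : HasAsymp f φ :=
  fun N => ⟨_, X_pow_dvd_sub_trunc φ N, by simpa only [aeval_trunc] using h N⟩

theorem isBigO_pow_zero_of_le {M N : ℕ} (h : M ≤ N) :
    (fun z : ℂ => z ^ N) =O[𝓝 0] (fun z => z ^ M) := by
  obtain ⟨d, rfl⟩ := Nat.exists_eq_add_of_le h
  simp_rw [pow_add]
  simpa using (isBigO_refl (fun z : ℂ => z ^ M) (𝓝 0)).mul
    ((continuous_pow d (M := ℂ)).continuousAt.isBigO_one ℂ)

theorem HasAsymp.comp {f g : ℂ → ℂ} {φ ψ : PowerSeries ℚ} (hf : HasAsymp f φ) (hg : HasAsymp g ψ)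
    (hψ : PowerSeries.constantCoeff ψ = 0) : HasAsymp (f ∘ g) (φ.subst ψ) := by
  have hs : PowerSeries.HasSubst ψ := PowerSeries.HasSubst.of_constantCoeff_zero' hψ
  have hX : (PowerSeries.X : PowerSeries ℚ) ∣ ψ := PowerSeries.X_dvd_iff.mpr hψ
  have hgO : g =O[𝓝 0] (fun z => z) := by
    simpa [hψ] using hg.isBigO_sub_sum 1
  have hg0 : Tendsto g (𝓝 0) (𝓝 0) := hgO.trans_tendsto tendsto_id
  intro N
  obtain ⟨p, hp, hpf⟩ := hf N
  obtain ⟨q, hq, hqg⟩ := hg (N + 1)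
  refine ⟨p.comp q, ?_, ?_⟩
  · have h1 : (PowerSeries.X : PowerSeries ℚ) ^ N ∣ (φ - p).subst ψ := by
      obtain ⟨r, hr⟩ := hp
      rw [hr, PowerSeries.subst_mul hs, PowerSeries.subst_pow hs, PowerSeries.subst_X hs]
      exact (pow_dvd_pow_of_dvd hX N).mul_right _
    have h2 : (PowerSeries.X : PowerSeries ℚ) ^ N ∣
        Polynomial.aeval ψ p - Polynomial.aeval (q : PowerSeries ℚ) p := by
      refine ((pow_dvd_pow _ N.le_succ).trans hq).trans ?_
      rw [← Polynomial.eval_map_algebraMap, ← Polynomial.eval_map_algebraMap]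
      exact Polynomial.sub_dvd_eval_sub _ _ _
    rw [PowerSeries.subst_sub hs, PowerSeries.subst_coe hs] at h1
    have h3 : ((p.comp q : Polynomial ℚ) : PowerSeries ℚ) =
        Polynomial.aeval (q : PowerSeries ℚ) p := by
      have := Polynomial.aeval_algHom_apply
        (Polynomial.coeToPowerSeries.algHom (R := ℚ) ℚ) q p
      simpa [Polynomial.coeToPowerSeries.algHom_apply, Polynomial.comp_eq_aeval] using this.symm
    rw [h3]
    simpa using dvd_add h1 h2
  · have hq0 : Tendsto (fun z : ℂ => Polynomial.aeval z q) (𝓝 0) (𝓝 0) := by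
      have h1 : Tendsto (fun z : ℂ => g z - (g z - Polynomial.aeval z q)) (𝓝 0) (𝓝 (0 - 0)) := by
        refine hg0.sub (hqg.trans_tendsto ?_)
        simpa using (continuous_pow (N + 1) (M := ℂ)).tendsto 0
      simpa using h1
    have h1 : (fun z => f (g z) - Polynomial.aeval (g z) p) =O[𝓝 0] (fun z => z ^ N) :=
      (hpf.comp_tendsto hg0).trans (hgO.pow N)
    have h2 := isBigO_aeval_sub (p := p) hg0 hq0 (hqg.trans (isBigO_pow_zero_of_le N.le_succ))
    refine (h1.add h2).congr_left fun z => ?_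
    rw [Polynomial.aeval_comp, Function.comp_apply]
    ring

theorem hasAsymp_tsum {c : ℕ → ℚ} (hc : ∀ z : ℂ, ‖z‖ < 1 → Summable fun m => (c m : ℂ) * z ^ m) :
    HasAsymp (fun z => ∑' m, (c m : ℂ) * z ^ m) (PowerSeries.mk c) := by
  refine hasAsymp_of_isBigO fun N => ?_
  have hs : Summable fun m => ‖(c (m + N) : ℂ) * (1 / 2 : ℂ) ^ m‖ := by
    have h1 := (summable_nat_add_iff N).mpr (hc (1 / 2) (by norm_num)).norm
    refine (h1.mul_left (2 ^ N)).congr fun m => ?_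
    simp [pow_add]
    field_simp
  refine IsBigO.of_bound (∑' m, ‖(c (m + N) : ℂ) * (1 / 2 : ℂ) ^ m‖) ?_
  filter_upwards [Metric.ball_mem_nhds (0 : ℂ) (by norm_num : (0 : ℝ) < 1 / 2)] with z hz
  rw [mem_ball_zero_iff] at hz
  have hz1 := hc z (by linarith)
  simp only [PowerSeries.coeff_mk]
  rw [← hz1.sum_add_tsum_nat_add N, add_sub_cancel_left]
  have h2 : ∀ m, (c (m + N) : ℂ) * z ^ (m + N) = z ^ N * ((c (m + N) : ℂ) * z ^ m) :=
    fun m => by ring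
  simp_rw [h2]
  rw [tsum_mul_left, norm_mul, mul_comm, norm_pow]
  gcongr
  refine tsum_of_norm_bounded hs.hasSum fun m => ?_
  rw [norm_mul, norm_mul, norm_pow, norm_pow]
  gcongr
  simpa using hz.le

theorem hasAsymp_one_sub_exp_neg : HasAsymp (fun z => 1 - Complex.exp (-z)) oneSubExpNeg := by
  refine hasAsymp_of_isBigO fun N => ?_
  rcases N with _ | N
  · simpa using (show Continuous fun z : ℂ => 1 - Complex.exp (-z) by fun_prop).continuousAt.isBigO_one ℂ
  have h1 := (Complex.exp_sub_sum_range_isBigO_pow (N + 1)).comp_tendsto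
    (show Tendsto (fun z : ℂ => -z) (𝓝 0) (𝓝 0) by simpa using (continuous_neg (G := ℂ)).tendsto 0)
  have h2 : (fun z : ℂ => (-z) ^ (N + 1)) =O[𝓝 0] (fun z => z ^ (N + 1)) :=
    IsBigO.of_bound 1 (by simp)
  refine (h1.trans h2).neg_left.congr_left fun z => ?_
  rw [Finset.sum_range_succ']
  have h3 : ∀ j, ((PowerSeries.coeff (j + 1) oneSubExpNeg : ℚ) : ℂ) * z ^ (j + 1) =
      -((-z) ^ (j + 1) / ((j + 1).factorial : ℂ)) := by
    intro j
    simp [oneSubExpNeg, PowerSeries.evalNegHom, PowerSeries.coeff_rescale, PowerSeries.coeff_one,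
      PowerSeries.coeff_exp, neg_pow z]
    ring
  simp_rw [h3]
  have h4 : PowerSeries.coeff 0 oneSubExpNeg = 0 := by
    rw [oneSubExpNeg, PowerSeries.evalNegHom, map_sub, PowerSeries.coeff_rescale]
    simp
  rw [h4, Function.comp_apply, Finset.sum_range_succ', Finset.sum_neg_distrib]
  simp
  ring

theorem integral_pow_mul_exp_neg_mul_Ioi (K : ℕ) {c : ℝ} (hc : 0 < c) :
    ∫ x in Ioi (0 : ℝ), x ^ K * Real.exp (-(c * x)) = K.factorial / c ^ (K + 1) := by
  have h := Real.integral_rpow_mul_exp_neg_mul_Ioi (a := K + 1) (by positivity) hc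
  rw [Real.Gamma_nat_eq_factorial] at h
  simp only [add_sub_cancel_right, Real.rpow_natCast] at h
  rw [h, one_div, Real.inv_rpow hc.le, div_eq_inv_mul]
  congr 2
  exact_mod_cast Real.rpow_natCast c (K + 1)

theorem integrableOn_pow_mul_exp_neg_mul_Ioi (K : ℕ) {c : ℝ} (hc : 0 < c) :
    IntegrableOn (fun x : ℝ => x ^ K * Real.exp (-(c * x))) (Ioi 0) :=
  .of_integral_ne_zero (by rw [integral_pow_mul_exp_neg_mul_Ioi K hc]; positivity)

theorem hasSum_choose_mul_pow_succ (i : ℕ) {w : ℂ} (hw : ‖w‖ < 1) :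
    HasSum (fun m : ℕ => (m.choose i : ℂ) * w ^ (m + 1)) ((w / (1 - w)) ^ (i + 1)) := by
  rw [← hasSum_nat_add_iff' i, Finset.sum_eq_zero, sub_zero]
  · have h := (hasSum_choose_mul_geometric_of_norm_lt_one i hw).mul_left (w ^ (i + 1))
    rw [mul_one_div, ← div_pow] at h
    refine h.congr_fun fun m => ?_
    ring
  · intro m hm
    rw [Nat.choose_eq_zero_of_lt (Finset.mem_range.mp hm), Nat.cast_zero, zero_mul]

/-- The integral representation of `∑ m, (m.choose i) / (m + 1) ^ (K + 1) * z ^ (m + 1)`. -/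
noncomputable def polylogIntegral (K i : ℕ) (z : ℂ) : ℂ :=
  ((K.factorial : ℂ))⁻¹ * ∫ x in Ioi (0 : ℝ), (x : ℂ) ^ K *
    (z * Real.exp (-x) / (1 - z * Real.exp (-x))) ^ (i + 1)

theorem hasSum_polylogIntegral (K i : ℕ) {z : ℂ} (hz : ‖z‖ < 1) :
    HasSum (fun m : ℕ => (m.choose i : ℂ) / (m + 1) ^ (K + 1) * z ^ (m + 1))
      (polylogIntegral K i z) := by
  let F : ℕ → ℝ → ℂ := fun m x => ((m.choose i : ℂ) * z ^ (m + 1)) *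
    ((x ^ K * Real.exp (-((m + 1 : ℝ) * x)) : ℝ) : ℂ)
  have hm : ∀ m : ℕ, (0 : ℝ) < m + 1 := fun m => by positivity
  have hint : ∀ m, IntegrableOn (F m) (Ioi 0) := fun m =>
    ((integrableOn_pow_mul_exp_neg_mul_Ioi K (hm m)).ofReal).const_mul _
  have hnorm : ∀ m, ∫ x in Ioi (0 : ℝ), ‖F m x‖ =
      ‖(m.choose i : ℂ) * z ^ (m + 1)‖ * (K.factorial / (m + 1) ^ (K + 1)) := by
    intro m
    rw [← integral_pow_mul_exp_neg_mul_Ioi K (hm m), ← integral_const_mul]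
    refine setIntegral_congr_fun measurableSet_Ioi fun x hx => ?_
    have : (0 : ℝ) < x := hx
    simp only [F]
    rw [norm_mul, Complex.norm_real, Real.norm_of_nonneg (by positivity)]
  have hsum : Summable fun m => ∫ x in Ioi (0 : ℝ), ‖F m x‖ := by
    simp_rw [hnorm]
    refine Summable.of_nonneg_of_le (fun m => by positivity) (fun m => ?_)
      ((hasSum_choose_mul_pow_succ i hz).summable.norm.mul_right (K.factorial : ℝ))
    gcongr
    refine div_le_self (by positivity) (one_le_pow₀ ?_)
    simp
  have h := (hasSum_integral_of_summable_integral_norm hint hsum).mul_left ((K.factorial : ℂ))⁻¹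
  have h1 : ∀ x ∈ Ioi (0 : ℝ), ∑' m, F m x = (x : ℂ) ^ K *
      (z * Real.exp (-x) / (1 - z * Real.exp (-x))) ^ (i + 1) := by
    intro x hx
    have hw : ‖z * Real.exp (-x)‖ < 1 := by
      rw [norm_mul, Complex.norm_real, Real.norm_of_nonneg (by positivity)]
      have : Real.exp (-x) ≤ 1 := Real.exp_le_one_iff.mpr (by simpa using (le_of_lt hx))
      exact (mul_le_of_le_one_right (norm_nonneg _) this).trans_lt hz
    refine HasSum.tsum_eq ?_
    refine ((hasSum_choose_mul_pow_succ i hw).mul_left ((x : ℂ) ^ K)).congr_fun fun m => ?_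
    have : Real.exp (-((m + 1 : ℝ) * x)) = Real.exp (-x) ^ (m + 1) := by
      rw [← Real.exp_nat_mul]
      push_cast
      ring_nf
    simp only [F, this]
    push_cast
    ring
  rw [setIntegral_congr_fun measurableSet_Ioi h1] at h
  refine h.congr_fun fun m => ?_
  simp only [F]
  rw [integral_const_mul, integral_complex_ofReal, integral_pow_mul_exp_neg_mul_Ioi K (hm m)]
  have : (K.factorial : ℂ) ≠ 0 := by exact_mod_cast K.factorial_ne_zero
  push_cast
  field_simp

theorem isOpen_cutPlane : IsOpen cutPlane :=
  (isOpen_lt Complex.continuous_re continuous_const).union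
    (isOpen_ne_fun Complex.continuous_im continuous_const)

theorem mul_ofReal_mem_cutPlane {z : ℂ} (hz : z ∈ cutPlane) {u : ℝ} (hu : u ∈ Icc (0 : ℝ) 1) :
    z * u ∈ cutPlane := by
  rcases hu.1.eq_or_lt with rfl | h0
  · left; simp
  rcases hz with h | h
  · left
    rw [Complex.re_mul_ofReal]
    rcases le_or_gt z.re 0 with h2 | h2
    · nlinarith
    · nlinarith [hu.2]
  · right
    rw [Complex.im_mul_ofReal]
    exact mul_ne_zero h h0.ne'

theorem one_sub_ne_zero_of_mem_cutPlane {z : ℂ} (hz : z ∈ cutPlane) : 1 - z ≠ 0 := by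
  intro h
  rw [sub_eq_zero] at h
  subst h
  rcases hz with h | h <;> simp at h

theorem mem_cutPlane_of_norm_lt_one {z : ℂ} (hz : ‖z‖ < 1) : z ∈ cutPlane :=
  Or.inl ((Complex.re_le_norm z).trans_lt hz)

theorem isPreconnected_cutPlane : IsPreconnected cutPlane := by
  have h0 : (0 : ℂ) ∈ cutPlane := mem_cutPlane_of_norm_lt_one (by simp)
  have h : StarConvex ℝ (0 : ℂ) cutPlane := by
    rw [starConvex_zero_iff]
    intro z hz a ha ha1
    rw [Complex.real_smul, mul_comm]
    exact mul_ofReal_mem_cutPlane hz ⟨ha, ha1⟩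
  exact (h.isPathConnected h0).isConnected.isPreconnected

theorem differentiableOn_polylogIntegral (K i : ℕ) :
    DifferentiableOn ℂ (polylogIntegral K i) cutPlane := by
  intro z₀ hz₀
  refine DifferentiableAt.differentiableWithinAt ?_
  unfold polylogIntegral
  refine DifferentiableAt.const_mul ?_ _
  obtain ⟨ε, hε, hball⟩ := Metric.nhds_basis_closedBall.mem_iff.mp
    (isOpen_cutPlane.mem_nhds hz₀)
  have hexp : ∀ x ∈ Ioi (0 : ℝ), Real.exp (-x) ∈ Icc (0 : ℝ) 1 := fun x hx =>
    ⟨(Real.exp_pos _).le, Real.exp_le_one_iff.mpr (by simpa using (le_of_lt hx))⟩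
  have hne : ∀ p ∈ Metric.closedBall z₀ ε ×ˢ Icc (0 : ℝ) 1, 1 - p.1 * (p.2 : ℂ) ≠ 0 :=
    fun p hp => one_sub_ne_zero_of_mem_cutPlane (mul_ofReal_mem_cutPlane (hball hp.1) hp.2)
  have hne' : ∀ z ∈ Metric.closedBall z₀ ε, ∀ x ∈ Ioi (0 : ℝ),
      1 - z * (Real.exp (-x) : ℂ) ≠ 0 := fun z hz x hx => hne (z, Real.exp (-x)) ⟨hz, hexp x hx⟩
  have hcpt : IsCompact (Metric.closedBall z₀ ε ×ˢ Icc (0 : ℝ) 1) :=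
    (isCompact_closedBall z₀ ε).prod isCompact_Icc
  obtain ⟨C, hC⟩ := hcpt.exists_bound_of_continuousOn (f := fun p : ℂ × ℝ =>
    (i + 1) * (p.1 * p.2 / (1 - p.1 * p.2)) ^ i * (1 / (1 - p.1 * (p.2 : ℂ)) ^ 2)) (by
      refine ContinuousOn.mul (continuousOn_const.mul ((ContinuousOn.div (by fun_prop)
        (by fun_prop) hne).pow _)) (ContinuousOn.div (by fun_prop) (by fun_prop) ?_)
      exact fun p hp => pow_ne_zero _ (hne p hp))
  obtain ⟨C', hC'⟩ := hcpt.exists_bound_of_continuousOn (f := fun p : ℂ × ℝ =>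
    (p.1 * p.2 / (1 - p.1 * p.2)) ^ i * (p.1 / (1 - p.1 * (p.2 : ℂ)))) (by
      exact ContinuousOn.mul ((ContinuousOn.div (by fun_prop)
        (by fun_prop) hne).pow _) (ContinuousOn.div (by fun_prop) (by fun_prop) hne))
  have hmeas : ∀ z ∈ Metric.closedBall z₀ ε, AEStronglyMeasurable (fun x : ℝ => (x : ℂ) ^ K *
      (z * Real.exp (-x) / (1 - z * Real.exp (-x))) ^ (i + 1)) (volume.restrict (Ioi 0)) := by
    intro z hz
    refine ContinuousOn.aestronglyMeasurable ?_ measurableSet_Ioi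
    exact ContinuousOn.mul (by fun_prop) ((ContinuousOn.div (by fun_prop)
        (by fun_prop) (hne' z hz)).pow _)
  have hz₀' : z₀ ∈ Metric.closedBall z₀ ε := Metric.mem_closedBall_self hε.le
  have hdom : IntegrableOn (fun x : ℝ => x ^ K * Real.exp (-x)) (Ioi 0) := by
    simpa using integrableOn_pow_mul_exp_neg_mul_Ioi K one_pos
  refine (hasDerivAt_integral_of_dominated_loc_of_deriv_le
    (F := fun (z : ℂ) (x : ℝ) => (x : ℂ) ^ K *
      (z * Real.exp (-x) / (1 - z * Real.exp (-x))) ^ (i + 1))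
    (F' := fun (z : ℂ) (x : ℝ) => (x : ℂ) ^ K *
      (((i + 1) * (z * Real.exp (-x) / (1 - z * Real.exp (-x))) ^ i *
        (1 / (1 - z * (Real.exp (-x) : ℂ)) ^ 2)) * Real.exp (-x)))
    (bound := fun x => C * (x ^ K * Real.exp (-x)))
    (Metric.closedBall_mem_nhds z₀ hε) ?_ ?_ ?_ ?_ ?_ ?_).2.differentiableAt
  · filter_upwards [Metric.closedBall_mem_nhds z₀ hε] with z hz using hmeas z hz
  · refine Integrable.mono' (hdom.const_mul C') (hmeas z₀ hz₀') ?_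
    filter_upwards [ae_restrict_mem measurableSet_Ioi] with x hx
    have hx0 : (0 : ℝ) < x := hx
    have h := hC' (z₀, Real.exp (-x)) ⟨hz₀', hexp x hx⟩
    have h2 : (x : ℂ) ^ K * (z₀ * Real.exp (-x) / (1 - z₀ * Real.exp (-x))) ^ (i + 1) =
        ((z₀ * Real.exp (-x) / (1 - z₀ * Real.exp (-x))) ^ i *
          (z₀ / (1 - z₀ * (Real.exp (-x) : ℂ)))) * ((x ^ K * Real.exp (-x) : ℝ) : ℂ) := by
      push_cast
      ring
    rw [h2, norm_mul, Complex.norm_real, Real.norm_of_nonneg (by positivity)]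
    gcongr
  · refine ContinuousOn.aestronglyMeasurable ?_ measurableSet_Ioi
    refine ContinuousOn.mul (by fun_prop) (ContinuousOn.mul (ContinuousOn.mul
      (continuousOn_const.mul ((ContinuousOn.div (by fun_prop)
        (by fun_prop) (hne' z₀ hz₀')).pow _)) (ContinuousOn.div (by fun_prop) (by fun_prop) ?_))
        (by fun_prop))
    exact fun x hx => pow_ne_zero _ (hne' z₀ hz₀' x hx)
  · filter_upwards [ae_restrict_mem measurableSet_Ioi] with x hx z hz
    have hx0 : (0 : ℝ) < x := hx
    have h := hC (z, Real.exp (-x)) ⟨hz, hexp x hx⟩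
    rw [mul_left_comm, norm_mul, ← Complex.ofReal_pow, ← Complex.ofReal_mul, Complex.norm_real,
      Real.norm_of_nonneg (by positivity)]
    gcongr
  · exact hdom.const_mul C
  · filter_upwards [ae_restrict_mem measurableSet_Ioi] with x hx z hz
    have h0 := hne' z hz x hx
    have h1 : HasDerivAt (fun z : ℂ => z * (Real.exp (-x) : ℂ)) (Real.exp (-x) : ℂ) z :=
      hasDerivAt_mul_const _
    have h2 := ((h1.div (h1.const_sub 1) h0).pow (i + 1)).const_mul ((x : ℂ) ^ K)
    refine h2.congr_deriv ?_
    simp only [Pi.div_apply, Nat.add_sub_cancel]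
    push_cast
    ring

theorem exists_norm_polylogIntegral_neg_le (K i : ℕ) :
    ∃ C : ℝ, ∀ r : ℝ, 0 ≤ r → ‖polylogIntegral K i (-(r : ℂ))‖ ≤ C * √r := by
  refine ⟨‖((K.factorial : ℂ))⁻¹‖ *
    ∫ x in Ioi (0 : ℝ), x ^ K * Real.exp (-(1 / 2 * x)), fun r hr => ?_⟩
  rw [polylogIntegral, norm_mul, mul_assoc, ← integral_mul_const]
  gcongr
  refine norm_integral_le_of_norm_le
    ((integrableOn_pow_mul_exp_neg_mul_Ioi K (by norm_num)).mul_const _) ?_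
  filter_upwards [ae_restrict_mem measurableSet_Ioi] with x hx
  have hx0 : (0 : ℝ) < x := hx
  set w : ℝ := r * Real.exp (-x) with hw
  have hw0 : 0 ≤ w := by positivity
  have h1 : -(r : ℂ) * Real.exp (-x) / (1 - -(r : ℂ) * Real.exp (-x)) = ((-(w / (1 + w)) : ℝ) : ℂ) := by
    rw [hw]
    push_cast
    ring
  have h2 : √w = Real.exp (-(1 / 2 * x)) * √r := by
    rw [hw, Real.sqrt_mul hr, ← Real.exp_half, mul_comm]
    ring_nf
  have h3 : 0 ≤ w / (1 + w) := by positivity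
  have h4 : w / (1 + w) ≤ 1 := (div_le_one (by positivity)).mpr (by linarith)
  have h5 : w / (1 + w) ≤ √w := by
    rw [div_le_iff₀ (by positivity)]
    have := Real.sq_sqrt hw0
    nlinarith [Real.sqrt_nonneg w, sq_nonneg (√w - 1)]
  rw [h1, norm_mul, norm_pow, Complex.norm_real, norm_pow, Complex.norm_real, norm_neg,
    Real.norm_of_nonneg hx0.le, Real.norm_of_nonneg h3, mul_assoc, ← h2]
  gcongr
  exact (pow_le_of_le_one h3 h4 (by lia)).trans h5

theorem exists_succ_pow_eq_sum_choose (n : ℕ) :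
    ∃ a : ℕ → ℚ, ∀ l : ℕ, ((l : ℚ) + 1) ^ n = ∑ i ∈ Finset.range (n + 1), a i * (l.choose i : ℚ) := by
  induction n with
  | zero => exact ⟨fun _ => 1, fun l => by simp⟩
  | succ n ih =>
    obtain ⟨a, ha⟩ := ih
    refine ⟨fun i => (if i < n + 1 then (i + 1) * a i else 0) + i * a (i - 1), fun l => ?_⟩
    simp only [add_mul]
    rw [Finset.sum_add_distrib, Finset.sum_range_succ _ (n + 1),
      Finset.sum_range_succ' (fun i : ℕ => (i : ℚ) * a (i - 1) * (l.choose i : ℚ)), pow_succ, ha,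
      Finset.sum_mul]
    simp only [lt_irrefl, if_false, zero_mul, add_zero, Nat.cast_zero, Nat.add_sub_cancel]
    rw [← Finset.sum_add_distrib]
    refine Finset.sum_congr rfl fun i hi => ?_
    rw [if_pos (Finset.mem_range.mp hi)]
    have h1 : ((l : ℚ) + 1) * (l.choose i : ℚ) = ((l + 1).choose (i + 1) : ℚ) * (i + 1) := by
      exact_mod_cast Nat.add_one_mul_choose_eq l i
    rw [Nat.choose_succ_succ] at h1
    push_cast at h1 ⊢
    linear_combination (a i) * h1

theorem sum_range_choose_eq_choose_succ (m i : ℕ) :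
    ∑ l ∈ Finset.range m, l.choose i = m.choose (i + 1) := by
  induction m with
  | zero => simp
  | succ m ih => rw [Finset.sum_range_succ, ih, Nat.choose_succ_succ, add_comm]

theorem exists_liCoeff_succ_eq (n k : ℕ) :
    ∃ a : ℕ → ℚ, ∀ m : ℕ, liCoeff (-(n : ℤ)) (k : ℤ) (m + 1) =
      ∑ i ∈ Finset.range (n + 1), a i * ((m.choose (i + 1) : ℚ) / ((m : ℚ) + 1) ^ k) := by
  obtain ⟨a, ha⟩ := exists_succ_pow_eq_sum_choose n
  refine ⟨a, fun m => ?_⟩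
  have h1 : Finset.Ioo 0 (m + 1) = (Finset.range m).image (· + 1) := by
    ext x
    simp only [Finset.mem_Ioo, Finset.mem_image, Finset.mem_range]
    exact ⟨fun h => ⟨x - 1, by lia, by lia⟩, by rintro ⟨y, hy, rfl⟩; lia⟩
  rw [liCoeff, h1, Finset.sum_image (by simp)]
  have h2 : ∀ l : ℕ, 1 / (((l + 1 : ℕ) : ℚ) ^ (-(n : ℤ)) * ((m + 1 : ℕ) : ℚ) ^ (k : ℤ)) =
      ∑ i ∈ Finset.range (n + 1), a i * (l.choose i : ℚ) / ((m : ℚ) + 1) ^ k := by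
    intro l
    rw [zpow_neg, zpow_natCast, zpow_natCast, ← Finset.sum_div, ← ha]
    push_cast
    field_simp
  simp_rw [h2]
  rw [Finset.sum_comm]
  refine Finset.sum_congr rfl fun i _ => ?_
  rw [← sum_range_choose_eq_choose_succ, ← Finset.sum_div, ← Finset.mul_sum, mul_div_assoc]
  push_cast
  rfl

theorem exists_isDoublePolylog_norm_le (n : ℕ) {k : ℕ} (hk : 1 ≤ k) :
    ∃ L : ℂ → ℂ, IsDoublePolylog (-(n : ℤ)) (k : ℤ) L ∧
      ∃ C : ℝ, ∀ r : ℝ, 0 ≤ r → ‖L (-(r : ℂ))‖ ≤ C * √r := by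
  obtain ⟨a, ha⟩ := exists_liCoeff_succ_eq n k
  obtain ⟨K, rfl⟩ := Nat.exists_eq_add_of_le' hk
  choose C hC using exists_norm_polylogIntegral_neg_le K
  refine ⟨fun z => ∑ i ∈ Finset.range (n + 1), (a i : ℂ) * polylogIntegral K (i + 1) z,
    ⟨fun z hz => ?_, ?_⟩, ∑ i ∈ Finset.range (n + 1), ‖(a i : ℂ)‖ * C (i + 1), fun r hr => ?_⟩
  · rw [← hasSum_nat_add_iff' 1]
    simp only [Finset.range_one, Finset.sum_singleton, liCoeff_zero, Rat.cast_zero, zero_mul,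
      sub_zero]
    refine (hasSum_sum fun i _ => (hasSum_polylogIntegral K (i + 1) hz).mul_left (a i : ℂ)).congr_fun
      fun m => ?_
    rw [ha]
    push_cast
    rw [Finset.sum_mul]
    exact Finset.sum_congr rfl fun i _ => by ring
  · exact DifferentiableOn.fun_sum fun i _ =>
      (differentiableOn_polylogIntegral K (i + 1)).const_mul _
  · rw [Finset.sum_mul]
    refine (norm_sum_le _ _).trans (Finset.sum_le_sum fun i _ => ?_)
    rw [norm_mul, mul_assoc]
    gcongr
    exact hC (i + 1) r hr

theorem IsDoublePolylog.eqOn {k₁ k₂ : ℤ} {L L' : ℂ → ℂ} (h : IsDoublePolylog k₁ k₂ L)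
    (h' : IsDoublePolylog k₁ k₂ L') : EqOn L L' cutPlane := by
  refine (h.differentiableOn.analyticOnNhd isOpen_cutPlane).eqOn_of_preconnected_of_eventuallyEq
    (h'.differentiableOn.analyticOnNhd isOpen_cutPlane) isPreconnected_cutPlane
    (mem_cutPlane_of_norm_lt_one (z := 0) (by simp)) ?_
  filter_upwards [Metric.ball_mem_nhds (0 : ℂ) one_pos] with z hz
  rw [mem_ball_zero_iff] at hz
  exact (h.hasSum z hz).unique (h'.hasSum z hz)

theorem isDoublePolylog_doublePolylog (n : ℕ) {k : ℕ} (hk : 1 ≤ k) :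
    IsDoublePolylog (-(n : ℤ)) (k : ℤ) (doublePolylog (-(n : ℤ)) (k : ℤ)) :=
  Classical.epsilon_spec ((exists_isDoublePolylog_norm_le n hk).imp fun _ h => h.1)

theorem neg_ofReal_mem_cutPlane {r : ℝ} (hr : 0 ≤ r) : -(r : ℂ) ∈ cutPlane := by
  left
  rw [Complex.neg_re, Complex.ofReal_re]
  linarith

theorem exists_norm_doublePolylog_neg_le (n : ℕ) {k : ℕ} (hk : 1 ≤ k) :
    ∃ C : ℝ, ∀ r : ℝ, 0 ≤ r → ‖doublePolylog (-(n : ℤ)) (k : ℤ) (-(r : ℂ))‖ ≤ C * √r := by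
  obtain ⟨L, hL, C, hC⟩ := exists_isDoublePolylog_norm_le n hk
  refine ⟨C, fun r hr => ?_⟩
  rw [(isDoublePolylog_doublePolylog n hk).eqOn hL (neg_ofReal_mem_cutPlane hr)]
  exact hC r hr

/-- The function `t ↦ Li_{k₁,k₂}(1 - e ^ t) / (1 - e ^ t)`. -/
noncomputable def etaKernel (k₁ k₂ : ℤ) (t : ℝ) : ℂ :=
  doublePolylog k₁ k₂ (1 - Complex.exp (t : ℂ)) / (1 - Complex.exp (t : ℂ))

theorem one_sub_cexp_ofReal (t : ℝ) :
    1 - Complex.exp (t : ℂ) = -((Real.exp t - 1 : ℝ) : ℂ) := by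
  push_cast
  ring

theorem locallyIntegrableOn_etaKernel (n : ℕ) {k : ℕ} (hk : 1 ≤ k) :
    LocallyIntegrableOn (etaKernel (-(n : ℤ)) (k : ℤ)) (Ioi 0) := by
  refine ContinuousOn.locallyIntegrableOn ?_ measurableSet_Ioi
  have h0 : ∀ t ∈ Ioi (0 : ℝ), 0 < Real.exp t - 1 := fun t ht => by
    have := Real.one_lt_exp_iff.mpr ht
    linarith
  refine ContinuousOn.div ?_ (by fun_prop) fun t ht => ?_
  · refine (isDoublePolylog_doublePolylog n hk).differentiableOn.continuousOn.comp (by fun_prop) ?_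
    intro t ht
    simp only [one_sub_cexp_ofReal]
    exact neg_ofReal_mem_cutPlane (h0 t ht).le
  · rw [one_sub_cexp_ofReal, neg_ne_zero, Complex.ofReal_ne_zero]
    exact (h0 t ht).ne'

theorem etaKernel_isBigO_atTop (n : ℕ) {k : ℕ} (hk : 1 ≤ k) (b : ℝ) :
    etaKernel (-(n : ℤ)) (k : ℤ) =O[atTop] (fun t : ℝ => t ^ (-b)) := by
  obtain ⟨C, hC⟩ := exists_norm_doublePolylog_neg_le n hk
  have hexp : etaKernel (-(n : ℤ)) (k : ℤ) =O[atTop] (fun t : ℝ => Real.exp (-(1 / 2) * t)) := by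
    refine IsBigO.of_bound (C * √2) ?_
    filter_upwards [eventually_ge_atTop 1] with t ht
    have h1 : Real.exp t / 2 ≤ Real.exp t - 1 := by
      have := Real.add_one_le_exp t
      linarith
    have h0 : 0 < Real.exp t - 1 := lt_of_lt_of_le (by positivity) h1
    have h2 := hC _ h0.le
    have h3 : 0 < √(Real.exp t - 1) := Real.sqrt_pos.mpr h0
    have hC0 : 0 ≤ C := by
      by_contra hneg
      have := (norm_nonneg _).trans h2
      nlinarith
    rw [etaKernel, one_sub_cexp_ofReal, norm_div, norm_neg, Complex.norm_real,
      Real.norm_of_nonneg h0.le, Real.norm_of_nonneg (Real.exp_pos _).le, div_le_iff₀ h0]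
    refine h2.trans ?_
    have h4 : 1 ≤ √2 * Real.exp (-(1 / 2) * t) * √(Real.exp t - 1) := by
      have h5 : Real.exp (-(1 / 2) * t) = √(Real.exp (-t)) := by
        rw [← Real.exp_half]; ring_nf
      rw [h5, ← Real.sqrt_mul (by norm_num), ← Real.sqrt_mul (by positivity), Real.one_le_sqrt]
      have h6 : Real.exp (-t) * Real.exp t = 1 := by rw [← Real.exp_add]; simp
      nlinarith [Real.exp_pos (-t)]
    calc C * √(Real.exp t - 1)
        ≤ C * √(Real.exp t - 1) * (√2 * Real.exp (-(1 / 2) * t) * √(Real.exp t - 1)) :=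
          le_mul_of_one_le_right (by positivity) h4
      _ = C * √2 * Real.exp (-(1 / 2) * t) * (√(Real.exp t - 1) * √(Real.exp t - 1)) := by ring
      _ = _ := by rw [Real.mul_self_sqrt h0.le]
  exact hexp.trans (isLittleO_exp_neg_mul_rpow_atTop (by norm_num) _).isBigO

theorem etaKernel_isBigO_zero (n : ℕ) {k : ℕ} (hk : 1 ≤ k) (N : ℕ) :
    (fun t : ℝ => etaKernel (-(n : ℤ)) (k : ℤ) t - ∑ j ∈ Finset.range N,
      ((-1) ^ j * ((PowerSeries.coeff j (bernoulliGen (-(n : ℤ)) (k : ℤ)) : ℚ) : ℂ)) * (t : ℂ) ^ j)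
      =O[𝓝[>] 0] (fun t : ℝ => t ^ N) := by
  have hL := isDoublePolylog_doublePolylog n hk
  set c : ℕ → ℚ := fun m => liCoeff (-(n : ℤ)) (k : ℤ) (m + 1) with hc
  have hsum : ∀ z : ℂ, ‖z‖ < 1 → HasSum (fun m => z * ((c m : ℂ) * z ^ m))
      (doublePolylog (-(n : ℤ)) (k : ℤ) z) := by
    intro z hz
    have h := hL.hasSum z hz
    rw [← hasSum_nat_add_iff' 1] at h
    simp only [Finset.range_one, Finset.sum_singleton, liCoeff_zero, Rat.cast_zero, zero_mul,
      sub_zero] at h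
    exact h.congr_fun fun m => by ring
  have hsummable : ∀ z : ℂ, ‖z‖ < 1 → Summable fun m => (c m : ℂ) * z ^ m := by
    intro z hz
    by_cases h0 : z = 0
    · refine summable_of_ne_finset_zero (s := {0}) fun m hm => ?_
      rw [h0, zero_pow (by simpa using hm), mul_zero]
    · exact (summable_mul_left_iff h0).mp (hsum z hz).summable
  have hconst : PowerSeries.constantCoeff oneSubExpNeg = 0 := by
    rw [oneSubExpNeg, PowerSeries.evalNegHom, map_sub,
      ← PowerSeries.coeff_zero_eq_constantCoeff_apply,
      ← PowerSeries.coeff_zero_eq_constantCoeff_apply, PowerSeries.coeff_rescale]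
    simp
  have hasymp := ((hasAsymp_tsum hsummable).comp hasAsymp_one_sub_exp_neg hconst).isBigO_sub_sum N
  have htend : Tendsto (fun t : ℝ => -(t : ℂ)) (𝓝[>] 0) (𝓝 0) := by
    have : Continuous fun t : ℝ => -(t : ℂ) := by fun_prop
    simpa using (this.tendsto 0).mono_left nhdsWithin_le_nhds
  have h1 := hasymp.comp_tendsto htend
  have h2 : (fun t : ℝ => (-(t : ℂ)) ^ N) =O[𝓝[>] 0] (fun t : ℝ => t ^ N) :=
    IsBigO.of_bound 1 (by simp)
  refine (h1.trans h2).congr' ?_ EventuallyEq.rfl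
  have htend2 : Tendsto (fun t : ℝ => 1 - Complex.exp (t : ℂ)) (𝓝[>] 0) (𝓝 0) := by
    have : Continuous fun t : ℝ => 1 - Complex.exp (t : ℂ) := by fun_prop
    simpa using (this.tendsto 0).mono_left nhdsWithin_le_nhds
  filter_upwards [htend2.eventually (Metric.ball_mem_nhds (0 : ℂ) one_pos),
    self_mem_nhdsWithin] with t ht ht0
  rw [dist_zero_right] at ht
  have hne : 1 - Complex.exp (t : ℂ) ≠ 0 := by
    rw [one_sub_cexp_ofReal, neg_ne_zero, Complex.ofReal_ne_zero]
    have := Real.one_lt_exp_iff.mpr ht0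
    linarith
  have h3 : etaKernel (-(n : ℤ)) (k : ℤ) t =
      ∑' m, (c m : ℂ) * (1 - Complex.exp (t : ℂ)) ^ m := by
    rw [etaKernel, ← (hsum _ ht).tsum_eq, tsum_mul_left, mul_div_cancel_left₀ _ hne]
  simp only [Function.comp_apply, neg_neg]
  rw [h3, bernoulliGen]
  congr 1
  refine Finset.sum_congr rfl fun j _ => ?_
  rw [neg_pow (t : ℂ)]
  ring

end MixedEta

theorem mainTheorem7 (n k : ℕ) (hk : 1 ≤ k) :
    -- the double polylogarithm in the definition of `η(-n, k; s)` exists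
    MixedEta.IsDoublePolylog (-(n : ℤ)) (k : ℤ) (MixedEta.doublePolylog (-(n : ℤ)) (k : ℤ)) ∧
    -- the integral that defines `η(-n, k; s)` converges absolutely for `Re s > 0`
    (∀ s : ℂ, 0 < s.re →
      MeasureTheory.IntegrableOn (MixedEta.etaIntegrand (-(n : ℤ)) (k : ℤ) s) (Set.Ioi 0)) ∧
    -- `η(-n, k; s)` extends to an entire function with the stated values
    ∃ E : ℂ → ℂ, Differentiable ℂ E ∧
      (∀ s : ℂ, 0 < s.re → E s = MixedEta.eta (-(n : ℤ)) (k : ℤ) s) ∧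
      ∀ m : ℕ, E (-(m : ℂ)) = (MixedEta.polyBernoulli (-(n : ℤ)) (k : ℤ) m : ℂ) := by
  obtain ⟨hconv, E, hE, hEeta, hEval⟩ := MixedEta.exists_entire_eq_inv_Gamma_mul_mellin
    (MixedEta.locallyIntegrableOn_etaKernel n hk) (MixedEta.etaKernel_isBigO_atTop n hk)
    (MixedEta.etaKernel_isBigO_zero n hk)
  refine ⟨MixedEta.isDoublePolylog_doublePolylog n hk, fun s hs => hconv s hs, E, hE,
    fun s hs => ?_, fun m => ?_⟩
  · rw [hEeta s hs, MixedEta.eta, one_div]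
    rfl
  · rw [hEval, MixedEta.polyBernoulli]
    push_cast
    have h : ((-1 : ℂ) ^ m) * (-1) ^ m = 1 := by rw [← mul_pow]; simp
    linear_combination ((m.factorial : ℂ) *
      ((PowerSeries.coeff m (MixedEta.bernoulliGen (-(n : ℤ)) (k : ℤ)) : ℚ) : ℂ)) * h
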